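/- **Lemma (Quant: the mixing morphisms are exactly the simple mixing maps).** For morphisms $f,g$ of a symmetric monoidal category write $f\oslash g$ if for all objects $A,B$ the morphism $f\otimes\mathrm{id}_A$ has the left lifting property with respect to $g\otimes\mathrm{id}_B$, i.e. for every commuting square $(g\otimes\mathrm{id}_B)\circ a=b\circ(f\otimes\mathrm{id}_A)$ there is a morphism $h$ with $h\circ(f\otimes\mathrm{id}_A)=a$ and $(g\otimes\mathrm{id}_B)\circ h=b$. Let $\mathbf{Quant}$ be the symmetric monoidal category whose objects are the nonzero finite-dimensional complex Hilbert spaces and whose morphisms $A\to B$ are the completely positive linear maps $B(A)\to B(B)$ (not necessarily trace preserving), with the usual tensor product, whose unit is $I=\mathbb C$. For each object $A$ let the completely mixed state $\mu_A\colon I\to A$ be the completely positive map $B(\mathbb C)=\mathbb C\to B(A)$ with $1\mapsto \mathrm{id}_A$. Call a morphism $g$ pure if $\mu_C\oslash g$ for every object $C$, let $\mathcal P$ be the class of pure morphisms, and let the class of mixing morphisms be $$\mathcal M=\{f\mid f\oslash g\text{ for all }g\in\mathcal P\}.$$ Then $\mathcal M$ consists of exactly the simple mixing maps: a morphism $m\colon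 A\to B$ of $\mathbf{Quant}$ is in $\mathcal M$ if and only if there are an object $C$ and an isomorphism $p\colon A\otimes C\to B$ in $\mathbf{Quant}$ with $$m=p\circ(\mathrm{id}_A\otimes\mu_C)$$ (where $A$ is identified with $A\otimes I$). -/

import Mathlib

open CategoryTheory MonoidalCategory
open scoped TensorProduct InnerProductSpace CStarAlgebra ComplexOrder

namespace CStarMatrix

theorem nonneg_iff_star_mul_self_aux {B : Type*} [NonUnitalCStarAlgebra B] [PartialOrder B]
    [StarOrderedRing B] (a : B) : 0 ≤ a ↔ ∃ b, a = star b * b :=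
  CStarAlgebra.nonneg_iff_eq_star_mul_self

theorem exists_negPart_aux {B : Type*} [NonUnitalCStarAlgebra B] [PartialOrder B]
    [StarOrderedRing B] (a : B) (ha : star a = a) :
    ∃ N b : B, star N * a * N = -(star b * b) ∧ (b = 0 → 0 ≤ a) := by
  have hN0 : 0 ≤ a⁻ := CFC.negPart_nonneg a
  have hNs : star a⁻ = a⁻ := hN0.isSelfAdjoint
  have h3 : 0 ≤ a⁻ * a⁻ * a⁻ := by
    have := star_left_conjugate_nonneg hN0 a⁻
    rwa [hNs] at this
  obtain ⟨b, hb⟩ := CStarAlgebra.nonneg_iff_eq_star_mul_self.mp h3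
  refine ⟨a⁻, b, ?_, ?_⟩
  · rw [hNs, ← hb]
    have h1 : a⁻ * a = -(a⁻ * a⁻) := by
      calc a⁻ * a = a⁻ * (a⁺ - a⁻) := by rw [CFC.posPart_sub_negPart a ha]
        _ = -(a⁻ * a⁻) := by rw [mul_sub, CFC.negPart_mul_posPart, zero_sub]
    rw [h1, neg_mul]
  · intro h0
    rw [h0, mul_zero] at hb
    rw [← CFC.negPart_eq_zero_iff a ha]
    have h2 : a⁻ * a⁻ = 0 := by
      rw [← CStarRing.star_mul_self_eq_zero_iff, star_mul, hNs, ← mul_assoc, hb, zero_mul]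
    rw [← CStarRing.star_mul_self_eq_zero_iff, hNs, h2]

variable {H : Type*} [NormedAddCommGroup H] [InnerProductSpace ℂ H]
variable {n : Type*} [Fintype n]

/-- The action of a square matrix of operators on column vectors. -/
def opAct (M : CStarMatrix n n (H →L[ℂ] H)) (x : n → H) : n → H := fun i => ∑ j, M i j (x j)

theorem opAct_mul (M N : CStarMatrix n n (H →L[ℂ] H)) (x : n → H) :
    opAct (M * N) x = opAct M (opAct N x) := by
  funext i
  simp only [opAct, CStarMatrix.mul_apply, sum_apply, mul_apply_eq_comp, map_sum]
  exact Finset.sum_comm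

theorem opAct_injective {M : CStarMatrix n n (H →L[ℂ] H)} (h : ∀ x, opAct M x = 0) : M = 0 := by
  classical
  ext i j v
  have := congrFun (h (Pi.single j v)) i
  rw [opAct, Finset.sum_eq_single j] at this
  · simpa using this
  · intro b _ hb
    simp [Pi.single_eq_of_ne hb]
  · simp

theorem eq_zero_of_sum_inner_opAct {M : CStarMatrix n n (H →L[ℂ] H)}
    (h : ∀ x : n → H, ∑ i, ⟪x i, opAct M x i⟫_ℂ = 0) : M = 0 := by
  let T : PiLp 2 (fun _ : n => H) →ₗ[ℂ] PiLp 2 (fun _ : n => H) :=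
    { toFun := fun x => WithLp.toLp 2 (opAct M x)
      map_add' := fun x y => by
        ext i; simp [opAct, Finset.sum_add_distrib]
      map_smul' := fun c x => by
        ext i; simp [opAct, Finset.smul_sum] }
  have hT : T = 0 := by
    rw [← inner_map_self_eq_zero]
    intro x
    rw [← inner_conj_symm, PiLp.inner_apply]
    exact (congrArg _ (h x.ofLp)).trans (map_zero _)
  refine opAct_injective fun x => ?_
  have := congrArg (fun S => WithLp.ofLp (S (WithLp.toLp 2 x))) hT
  simpa [T] using this

variable [CompleteSpace H]

theorem sum_inner_opAct_star (N : CStarMatrix n n (H →L[ℂ] H)) (x y : n → H) :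
    ∑ i, ⟪x i, opAct (star N) y i⟫_ℂ = ∑ i, ⟪opAct N x i, y i⟫_ℂ := by
  simp only [opAct, inner_sum, sum_inner, CStarMatrix.star_apply,
    ContinuousLinearMap.star_eq_adjoint, ContinuousLinearMap.adjoint_inner_right]
  exact Finset.sum_comm

/-- A square matrix of operators is positive in the C⋆-algebra of operator matrices exactly when
it is positive as an operator on column vectors. -/
theorem nonneg_iff_sum_inner_opAct (M : CStarMatrix n n (H →L[ℂ] H)) :
    0 ≤ M ↔ ∀ x : n → H, 0 ≤ ∑ i, ⟪x i, opAct M x i⟫_ℂ := by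
  have key : ∀ (b : CStarMatrix n n (H →L[ℂ] H)) (x : n → H),
      ∑ i, ⟪x i, opAct (star b * b) x i⟫_ℂ = ((∑ i, ‖opAct b x i‖ ^ 2 : ℝ) : ℂ) := by
    intro b x
    rw [opAct_mul, sum_inner_opAct_star]
    push_cast
    exact Finset.sum_congr rfl fun i _ => by
      rw [inner_self_eq_norm_sq_to_K]; rfl
  refine ⟨fun hM x => ?_, fun h => ?_⟩
  · obtain ⟨b, rfl⟩ := (nonneg_iff_star_mul_self_aux M).mp hM
    rw [key]
    exact_mod_cast Finset.sum_nonneg fun i _ => by positivity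
  have hsa : star M = M := by
    rw [← sub_eq_zero]
    refine eq_zero_of_sum_inner_opAct fun x => ?_
    have e : ∀ i, opAct (star M - M) x i = opAct (star M) x i - opAct M x i := by
      intro i; simp [opAct, Finset.sum_sub_distrib]
    simp only [e, inner_sub_right, Finset.sum_sub_distrib]
    rw [sum_inner_opAct_star, sub_eq_zero]
    have hr : (starRingEnd ℂ) (∑ i, ⟪x i, opAct M x i⟫_ℂ) = ∑ i, ⟪x i, opAct M x i⟫_ℂ :=
      Complex.conj_eq_iff_im.mpr (Complex.nonneg_iff.mp (h x)).2.symm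
    rw [← hr, map_sum]
    simp only [inner_conj_symm]
  obtain ⟨N, b, hNb, hb⟩ := exists_negPart_aux M hsa
  refine hb (opAct_injective fun x => ?_)
  have h4 := h (opAct N x)
  have e2 : ∑ i, ⟪opAct N x i, opAct M (opAct N x) i⟫_ℂ
      = -((∑ i, ‖opAct b x i‖ ^ 2 : ℝ) : ℂ) := by
    rw [← key, ← sum_inner_opAct_star, ← opAct_mul, ← opAct_mul, hNb]
    simp [opAct, inner_sum]
  rw [e2] at h4
  have h5 : (∑ i, ‖opAct b x i‖ ^ 2 : ℝ) ≤ 0 := by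
    have : (0 : ℝ) ≤ -(∑ i, ‖opAct b x i‖ ^ 2 : ℝ) := by exact_mod_cast h4
    linarith
  have h6 := (Finset.sum_eq_zero_iff_of_nonneg (fun i _ => by positivity)).mp
    (le_antisymm h5 (Finset.sum_nonneg fun i _ => by positivity))
  funext i
  simpa using h6 i (Finset.mem_univ i)

theorem nonneg_iff_sum_inner (M : CStarMatrix n n (H →L[ℂ] H)) :
    0 ≤ M ↔ ∀ x : n → H, 0 ≤ ∑ i, ∑ j, ⟪x i, M i j (x j)⟫_ℂ := by
  simp only [nonneg_iff_sum_inner_opAct, opAct, inner_sum]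

end CStarMatrix

/-- Objects of the category of quantum systems: nonzero finite-dimensional complex Hilbert
spaces (the zero space is excluded, since it has no nonzero state). -/
structure Quant where
  /-- the underlying Hilbert space -/
  carrier : Type
  [normedAddCommGroup : NormedAddCommGroup carrier]
  [innerProductSpace : InnerProductSpace ℂ carrier]
  [finiteDimensional : FiniteDimensional ℂ carrier]
  [nontrivial : Nontrivial carrier]

namespace Quant

instance : CoeSort Quant Type := ⟨carrier⟩

attribute [instance] normedAddCommGroup innerProductSpace finiteDimensional nontrivial

instance (A : Quant) : CompleteSpace A := FiniteDimensional.complete ℂ A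

/-- The algebra `B(A)` of operators on the Hilbert space `A`. -/
abbrev Op (A : Quant) : Type := A →L[ℂ] A

/-- Morphisms are the completely positive maps `B(A) → B(B)`; they need not preserve the trace. -/
@[ext]
structure Hom (A B : Quant) where
  /-- the underlying completely positive map -/
  cp : A.Op →CP B.Op

/-- Build a morphism from a linear map with a proof of complete positivity. -/
def Hom.ofLinear {A B : Quant} (Φ : A.Op →ₗ[ℂ] B.Op)
    (h : ∀ (k : ℕ) (M : CStarMatrix (Fin k) (Fin k) A.Op), 0 ≤ M → 0 ≤ M.map Φ) : Hom A B :=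
  ⟨{ Φ with map_cstarMatrix_nonneg' := h }⟩

/-- The underlying linear map of a morphism. -/
def Hom.lin {A B : Quant} (f : Hom A B) : A.Op →ₗ[ℂ] B.Op := f.cp.toLinearMap

@[simp] theorem Hom.lin_ofLinear {A B : Quant} (Φ : A.Op →ₗ[ℂ] B.Op) (h) :
    (Hom.ofLinear Φ h).lin = Φ := rfl

theorem Hom.lin_injective {A B : Quant} {f g : Hom A B} (h : f.lin = g.lin) : f = g := by
  obtain ⟨⟨f, hf⟩⟩ := f
  obtain ⟨⟨g, hg⟩⟩ := g
  obtain rfl : f = g := h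
  rfl

theorem Hom.nonneg {A B : Quant} (f : Hom A B) {n : Type*} [Fintype n]
    (M : CStarMatrix n n A.Op) (hM : 0 ≤ M) : 0 ≤ M.map f.lin :=
  f.cp.map_cstarMatrix_nonneg M hM

instance : Category Quant where
  Hom := Hom
  id A := Hom.ofLinear LinearMap.id fun _ _ h => h
  comp f g := Hom.ofLinear (g.lin ∘ₗ f.lin) fun _ _ h => g.nonneg _ (f.nonneg _ h)

/-- The underlying linear map `B(A) → B(B)` of a morphism `A ⟶ B`. -/
abbrev linMap {A B : Quant} (f : A ⟶ B) : A.Op →ₗ[ℂ] B.Op := Hom.lin f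

@[ext] theorem hom_ext {A B : Quant} {f g : A ⟶ B} (h : linMap f = linMap g) : f = g :=
  Hom.lin_injective h

@[simp] theorem linMap_id (A : Quant) : linMap (𝟙 A) = LinearMap.id := rfl

@[simp] theorem linMap_comp {A B C : Quant} (f : A ⟶ B) (g : B ⟶ C) :
    linMap (f ≫ g) = linMap g ∘ₗ linMap f := rfl

/-- A ⋆-homomorphism of operator algebras, as a morphism. -/
noncomputable def ofStarHom {A B : Quant} (φ : A.Op →⋆ₙₐ[ℂ] B.Op) : A ⟶ B :=
  Hom.ofLinear (φ : A.Op →ₗ[ℂ] B.Op) fun k M hM =>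
    CompletelyPositiveMapClass.map_cstarMatrix_nonneg' φ k M hM

@[simp] theorem linMap_ofStarHom {A B : Quant} (φ : A.Op →⋆ₙₐ[ℂ] B.Op) (X : A.Op) :
    linMap (ofStarHom φ) X = φ X := rfl

/-- Conjugation `X ↦ u X u⁻¹` by a unitary `u : A → B`, as an isomorphism. -/
noncomputable def conjIso {A B : Quant} (u : A ≃ₗᵢ[ℂ] B) : A ≅ B where
  hom := ofStarHom (NonUnitalStarAlgHomClass.toNonUnitalStarAlgHom u.conjStarAlgEquiv)
  inv := ofStarHom (NonUnitalStarAlgHomClass.toNonUnitalStarAlgHom u.symm.conjStarAlgEquiv)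
  hom_inv_id := by ext X x; simp
  inv_hom_id := by ext X x; simp

@[simp] theorem linMap_conjIso_hom {A B : Quant} (u : A ≃ₗᵢ[ℂ] B) (X : A.Op) :
    linMap (conjIso u).hom X = u.conjStarAlgEquiv X := rfl

@[simp] theorem linMap_conjIso_inv {A B : Quant} (u : A ≃ₗᵢ[ℂ] B) (X : B.Op) :
    linMap (conjIso u).inv X = u.symm.conjStarAlgEquiv X := rfl

/-- The tensor product of Hilbert spaces. -/
noncomputable abbrev tensor (A B : Quant) : Quant := ⟨A ⊗[ℂ] B⟩

/-- The canonical isomorphism `B(A) ⊗ B(B) ≃ B(A ⊗ B)`, sending `S ⊗ T` to the operator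
`S ⊗ T`. -/
noncomputable def opTensorEquiv (A B : Quant) : A.Op ⊗[ℂ] B.Op ≃ₗ[ℂ] (tensor A B).Op :=
  (TensorProduct.congr LinearMap.toContinuousLinearMap.symm
    LinearMap.toContinuousLinearMap.symm).trans
    ((homTensorHomEquiv ℂ A B A B).trans LinearMap.toContinuousLinearMap)

/-- The operator `S ⊗ T` on `A ⊗ B`. -/
noncomputable def tmulOp {A B : Quant} (S : A.Op) (T : B.Op) : (tensor A B).Op :=
  TensorProduct.mapL S T

theorem tmulOp_apply {A B : Quant} (S : A.Op) (T : B.Op) (a : A) (b : B) :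
    tmulOp S T (a ⊗ₜ[ℂ] b) = S a ⊗ₜ[ℂ] T b := rfl

theorem smul_tmulOp {A B : Quant} (c : ℂ) (S : A.Op) (T : B.Op) :
    tmulOp (c • S) T = c • tmulOp S T := TensorProduct.mapL_smul_left _ _ _

theorem tmulOp_smul {A B : Quant} (c : ℂ) (S : A.Op) (T : B.Op) :
    tmulOp S (c • T) = c • tmulOp S T := TensorProduct.mapL_smul_right _ _ _

@[simp] theorem opTensorEquiv_tmul {A B : Quant} (S : A.Op) (T : B.Op) :
    opTensorEquiv A B (S ⊗ₜ T) = tmulOp S T := by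
  refine ContinuousLinearMap.coe_injective (TensorProduct.ext' fun a b => ?_)
  simp [opTensorEquiv, tmulOp]

@[simp] theorem opTensorEquiv_symm_mapL {A B : Quant} (S : A.Op) (T : B.Op) :
    (opTensorEquiv A B).symm (tmulOp S T) = S ⊗ₜ T := by
  rw [LinearEquiv.symm_apply_eq, opTensorEquiv_tmul]

/-- Linear maps out of `B(A ⊗ B)` are determined on the operators `S ⊗ T`. -/
theorem op_ext {A B : Quant} {V : Type*} [AddCommGroup V] [Module ℂ V]
    {f g : (tensor A B).Op →ₗ[ℂ] V}
    (h : ∀ (S : A.Op) (T : B.Op), f (tmulOp S T) = g (tmulOp S T)) :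
    f = g := by
  have : f ∘ₗ (opTensorEquiv A B).toLinearMap = g ∘ₗ (opTensorEquiv A B).toLinearMap :=
    TensorProduct.ext' fun S T => by simpa using h S T
  ext1 X
  simpa using LinearMap.congr_fun this ((opTensorEquiv A B).symm X)

theorem op_ext₃ {A B C : Quant} {V : Type*} [AddCommGroup V] [Module ℂ V]
    {f g : (tensor (tensor A B) C).Op →ₗ[ℂ] V}
    (h : ∀ (S : A.Op) (T : B.Op) (U : C.Op),
      f (tmulOp (tmulOp S T) U)
        = g (tmulOp (tmulOp S T) U)) : f = g := by
  refine op_ext fun X U => ?_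
  have := op_ext (f := f ∘ₗ (opTensorEquiv _ C).toLinearMap ∘ₗ (TensorProduct.mk ℂ _ _).flip U)
    (g := g ∘ₗ (opTensorEquiv _ C).toLinearMap ∘ₗ (TensorProduct.mk ℂ _ _).flip U)
    fun S T => by simpa using h S T U
  simpa using LinearMap.congr_fun this X

theorem op_ext₄ {A B C D : Quant} {V : Type*} [AddCommGroup V] [Module ℂ V]
    {f g : (tensor (tensor (tensor A B) C) D).Op →ₗ[ℂ] V}
    (h : ∀ (S : A.Op) (T : B.Op) (U : C.Op) (W : D.Op),
      f (tmulOp (tmulOp (tmulOp S T) U) W)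
        = g (tmulOp (tmulOp (tmulOp S T) U) W)) : f = g := by
  refine op_ext fun X W => ?_
  have := op_ext₃ (f := f ∘ₗ (opTensorEquiv _ D).toLinearMap ∘ₗ (TensorProduct.mk ℂ _ _).flip W)
    (g := g ∘ₗ (opTensorEquiv _ D).toLinearMap ∘ₗ (TensorProduct.mk ℂ _ _).flip W)
    fun S T U => by simpa using h S T U W
  simpa using LinearMap.congr_fun this X

/-- The tensor product of linear maps `B(A) → B(A')` and `B(B) → B(B')`, characterised by
`S ⊗ T ↦ Φ(S) ⊗ Ψ(T)`. -/
noncomputable def tensorLin {A A' B B' : Quant} (Φ : A.Op →ₗ[ℂ] A'.Op) (Ψ : B.Op →ₗ[ℂ] B'.Op) :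
    (tensor A B).Op →ₗ[ℂ] (tensor A' B').Op :=
  (opTensorEquiv A' B').toLinearMap ∘ₗ TensorProduct.map Φ Ψ ∘ₗ (opTensorEquiv A B).symm.toLinearMap

@[simp] theorem tensorLin_mapL {A A' B B' : Quant} (Φ : A.Op →ₗ[ℂ] A'.Op)
    (Ψ : B.Op →ₗ[ℂ] B'.Op) (S : A.Op) (T : B.Op) :
    tensorLin Φ Ψ (tmulOp S T) = tmulOp (Φ S) (Ψ T) := by
  simp [tensorLin]

/-- The block of an operator on `A ⊗ L` at vectors `u v : L`: the operator
`(id ⊗ ⟨u|) X (id ⊗ |v⟩)` on `A`. -/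
noncomputable def block {A L : Quant} (u v : L) : (tensor A L).Op →ₗ[ℂ] A.Op :=
  TensorProduct.lift
    (LinearMap.mk₂ ℂ (fun (S : A.Op) (T : L.Op) => ⟪u, T v⟫_ℂ • S)
      (fun S S' T => by simp) (fun c S T => by rw [smul_comm])
      (fun S T T' => by simp [add_smul])
      (fun c S T => by simp [mul_smul])) ∘ₗ
    (opTensorEquiv A L).symm.toLinearMap

@[simp] theorem block_mapL {A L : Quant} (u v : L) (S : A.Op) (T : L.Op) :
    block u v (tmulOp S T) = ⟪u, T v⟫_ℂ • S := by
  simp [block]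

theorem inner_block {A L : Quant} (u v : L) (x y : A) (X : (tensor A L).Op) :
    ⟪x, block u v X y⟫_ℂ = ⟪x ⊗ₜ[ℂ] u, X (y ⊗ₜ[ℂ] v)⟫_ℂ := by
  let f : (tensor A L).Op →ₗ[ℂ] ℂ :=
    { toFun := fun X => ⟪x, block u v X y⟫_ℂ
      map_add' := fun X Y => by simp
      map_smul' := fun c X => by simp }
  let g : (tensor A L).Op →ₗ[ℂ] ℂ :=
    { toFun := fun X => ⟪x ⊗ₜ[ℂ] u, X (y ⊗ₜ[ℂ] v)⟫_ℂ
      map_add' := fun X Y => by simp [inner_add_right]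
      map_smul' := fun c X => inner_smul_right (𝕜 := ℂ) (x ⊗ₜ[ℂ] u) (X (y ⊗ₜ[ℂ] v)) c }
  have : f = g := op_ext fun S T => by
    have h1 : f (tmulOp S T) = ⟪x, S y⟫_ℂ * ⟪u, T v⟫_ℂ := by
      simp [f, mul_comm]
    exact h1.trans (TensorProduct.inner_tmul _ _ _ _ _).symm
  exact LinearMap.congr_fun this X

theorem block_tensorLin_id {A B L : Quant} (Φ : A.Op →ₗ[ℂ] B.Op) (u v : L)
    (X : (tensor A L).Op) :
    block u v (tensorLin Φ (LinearMap.id : L.Op →ₗ[ℂ] L.Op) X) = Φ (block u v X) := by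
  have : block u v ∘ₗ tensorLin Φ (LinearMap.id : L.Op →ₗ[ℂ] L.Op) = Φ ∘ₗ block u v :=
    op_ext fun S T => by simp
  exact LinearMap.congr_fun this X

theorem exists_sum_tmul {A L : Quant} {ι : Type*} [Fintype ι] (e : OrthonormalBasis ι ℂ L)
    (z : A ⊗[ℂ] L) : ∃ y : ι → A, z = ∑ k, y k ⊗ₜ[ℂ] e k := by
  induction z using TensorProduct.induction_on with
  | zero => exact ⟨0, by simp⟩
  | tmul a l =>
    refine ⟨fun k => ⟪e k, l⟫_ℂ • a, ?_⟩
    conv_lhs => rw [← e.sum_repr' l]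
    simp [TensorProduct.tmul_sum, TensorProduct.smul_tmul]
  | add z w hz hw =>
    obtain ⟨y, rfl⟩ := hz
    obtain ⟨y', rfl⟩ := hw
    exact ⟨y + y', by simp [TensorProduct.add_tmul, Finset.sum_add_distrib]⟩

theorem inner_sum_block {A L : Quant} {ι : Type*} [Fintype ι] (e : ι → L) (x y : ι → A)
    (X : (tensor A L).Op) :
    inner ℂ (∑ a, x a ⊗ₜ[ℂ] e a : tensor A L) (X (∑ b, y b ⊗ₜ[ℂ] e b)) =
      ∑ a, ∑ b, ⟪x a, block (e a) (e b) X (y b)⟫_ℂ := by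
  rw [map_sum, sum_inner]
  refine Finset.sum_congr rfl fun a _ => ?_
  rw [inner_sum]
  exact Finset.sum_congr rfl fun b _ => (inner_block _ _ _ _ _).symm

/-- Complete positivity is stable under tensoring with an identity. -/
theorem tensorLin_id_nonneg {A B : Quant} (f : A ⟶ B) (L : Quant) (k : ℕ)
    (M : CStarMatrix (Fin k) (Fin k) (tensor A L).Op) (hM : 0 ≤ M) :
    0 ≤ M.map (tensorLin (linMap f) (LinearMap.id : L.Op →ₗ[ℂ] L.Op)) := by
  let e := stdOrthonormalBasis ℂ L
  let N : CStarMatrix (Fin k × Fin (Module.finrank ℂ L)) (Fin k × Fin (Module.finrank ℂ L)) A.Op :=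
    CStarMatrix.ofMatrix fun p q => block (e p.2) (e q.2) (M p.1 q.1)
  have hN : 0 ≤ N := by
    rw [CStarMatrix.nonneg_iff_sum_inner] at hM ⊢
    intro x
    refine (hM fun i => ∑ a, x (i, a) ⊗ₜ[ℂ] e a).trans_eq ?_
    rw [Fintype.sum_prod_type]
    refine Finset.sum_congr rfl fun i _ => ?_
    simp_rw [Fintype.sum_prod_type]
    rw [Finset.sum_comm]
    exact Finset.sum_congr rfl fun j _ => inner_sum_block _ _ _ _
  have hfN := Hom.nonneg f N hN
  rw [CStarMatrix.nonneg_iff_sum_inner] at hfN ⊢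
  intro z
  choose y hy using fun i => exists_sum_tmul e (z i)
  refine (hfN fun p => y p.1 p.2).trans_eq ?_
  rw [Fintype.sum_prod_type]
  refine Finset.sum_congr rfl fun i _ => ?_
  simp_rw [Fintype.sum_prod_type]
  rw [Finset.sum_comm]
  refine Finset.sum_congr rfl fun j _ => ?_
  rw [hy i, hy j]
  refine Eq.trans ?_ (inner_sum_block _ _ _ _).symm
  refine Finset.sum_congr rfl fun a _ => Finset.sum_congr rfl fun b _ => ?_
  exact congrArg (fun S : B.Op => ⟪y i a, S (y j b)⟫_ℂ)
    (block_tensorLin_id (linMap f) (e a) (e b) (M i j)).symm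

/-- The morphism `f ⊗ id_L`. -/
noncomputable def whiskerR {A B : Quant} (f : A ⟶ B) (L : Quant) : tensor A L ⟶ tensor B L :=
  Hom.ofLinear (tensorLin (linMap f) LinearMap.id) (tensorLin_id_nonneg f L)

@[simp] theorem linMap_whiskerR {A B : Quant} (f : A ⟶ B) (L : Quant) (S : A.Op) (T : L.Op) :
    linMap (whiskerR f L) (tmulOp S T) = tmulOp (linMap f S) T :=
  tensorLin_mapL _ _ _ _

/-- The symmetry `A ⊗ B ≅ B ⊗ A`. -/
noncomputable def swap (A B : Quant) : tensor A B ≅ tensor B A :=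
  conjIso (TensorProduct.commIsometry ℂ A B)

/-- The associator. -/
noncomputable def assoc (A B C : Quant) : tensor (tensor A B) C ≅ tensor A (tensor B C) :=
  conjIso (TensorProduct.assocIsometry ℂ A B C)

/-- The monoidal unit, the one-dimensional Hilbert space `ℂ`. -/
noncomputable abbrev unit : Quant := ⟨ℂ⟩

/-- The left unitor. -/
noncomputable def lunit (A : Quant) : tensor unit A ≅ A :=
  conjIso (TensorProduct.lidIsometry ℂ A)

/-- The right unitor. -/
noncomputable def runit (A : Quant) : tensor A unit ≅ A :=
  conjIso (TensorProduct.ridIsometry ℂ A)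

@[simp] theorem linMap_swap {A B : Quant} (S : A.Op) (T : B.Op) :
    linMap (swap A B).hom (tmulOp S T) = tmulOp T S := by
  refine ContinuousLinearMap.coe_injective (TensorProduct.ext' fun b a => ?_)
  simp [swap, tmulOp]

@[simp] theorem linMap_assoc {A B C : Quant} (S : A.Op) (T : B.Op) (U : C.Op) :
    linMap (assoc A B C).hom (tmulOp (tmulOp S T) U) =
      tmulOp S (tmulOp T U) := by
  refine ContinuousLinearMap.coe_injective (TensorProduct.ext_threefold' fun a b c => ?_)
  simp [assoc, tmulOp]

@[simp] theorem linMap_assoc_inv {A B C : Quant} (S : A.Op) (T : B.Op) (U : C.Op) :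
    linMap (assoc A B C).inv (tmulOp S (tmulOp T U)) =
      tmulOp (tmulOp S T) U := by
  rw [← linMap_assoc]
  exact LinearMap.congr_fun (congrArg linMap (assoc A B C).hom_inv_id) _

@[simp] theorem linMap_lunit {A : Quant} (c : unit.Op) (S : A.Op) :
    linMap (lunit A).hom (tmulOp c S) = c 1 • S := by
  ext a
  simp [lunit, tmulOp]

@[simp] theorem linMap_runit {A : Quant} (S : A.Op) (c : unit.Op) :
    linMap (runit A).hom (tmulOp S c) = c 1 • S := by
  ext a
  simp [runit, tmulOp]

/-- The morphism `id_L ⊗ f`. -/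
noncomputable def whiskerL (L : Quant) {A B : Quant} (f : A ⟶ B) : tensor L A ⟶ tensor L B :=
  (swap L A).hom ≫ whiskerR f L ≫ (swap B L).hom

@[simp] theorem linMap_whiskerL {A B : Quant} (f : A ⟶ B) (L : Quant) (T : L.Op) (S : A.Op) :
    linMap (whiskerL L f) (tmulOp T S) = tmulOp T (linMap f S) := by
  simp only [whiskerL, linMap_comp, LinearMap.comp_apply, linMap_swap, linMap_whiskerR]

/-- The tensor product of completely positive maps. -/
noncomputable def tensorMor {A A' B B' : Quant} (f : A ⟶ A') (g : B ⟶ B') :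
    tensor A B ⟶ tensor A' B' :=
  whiskerR f B ≫ whiskerL A' g

@[simp] theorem linMap_tensorMor {A A' B B' : Quant} (f : A ⟶ A') (g : B ⟶ B')
    (S : A.Op) (T : B.Op) :
    linMap (tensorMor f g) (tmulOp S T) =
      tmulOp (linMap f S) (linMap g T) := by
  simp only [tensorMor, linMap_comp, LinearMap.comp_apply, linMap_whiskerR, linMap_whiskerL]

section Coherence

variable {A B C D A' B' C' : Quant}

theorem tensorMor_id (A B : Quant) : tensorMor (𝟙 A) (𝟙 B) = 𝟙 (tensor A B) :=
  hom_ext <| op_ext fun S T => by simp only [linMap_tensorMor, linMap_id, LinearMap.id_apply]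

theorem id_tensorMor (f : B ⟶ B') : tensorMor (𝟙 A) f = whiskerL A f :=
  hom_ext <| op_ext fun S T => by
    simp only [linMap_tensorMor, linMap_whiskerL, linMap_id, LinearMap.id_apply]

theorem tensorMor_id_right (f : A ⟶ A') : tensorMor f (𝟙 B) = whiskerR f B :=
  hom_ext <| op_ext fun S T => by
    simp only [linMap_tensorMor, linMap_whiskerR, linMap_id, LinearMap.id_apply]

theorem tensorMor_comp (f : A ⟶ B) (f' : A' ⟶ B') (g : B ⟶ C) (g' : B' ⟶ C') :
    tensorMor f f' ≫ tensorMor g g' = tensorMor (f ≫ g) (f' ≫ g') :=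
  hom_ext <| op_ext fun S T => by
    simp only [linMap_tensorMor, linMap_comp, LinearMap.comp_apply]

theorem assoc_naturality (f : A ⟶ A') (g : B ⟶ B') (h : C ⟶ C') :
    tensorMor (tensorMor f g) h ≫ (assoc A' B' C').hom =
      (assoc A B C).hom ≫ tensorMor f (tensorMor g h) :=
  hom_ext <| op_ext₃ fun S T U => by
    simp only [linMap_tensorMor, linMap_comp, LinearMap.comp_apply, linMap_assoc]

theorem lunit_naturality (f : A ⟶ B) :
    tensorMor (𝟙 unit) f ≫ (lunit B).hom = (lunit A).hom ≫ f :=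
  hom_ext <| op_ext fun c S => by
    simp only [linMap_tensorMor, linMap_comp, LinearMap.comp_apply, linMap_lunit, linMap_id,
      LinearMap.id_apply, map_smul]

theorem runit_naturality (f : A ⟶ B) :
    tensorMor f (𝟙 unit) ≫ (runit B).hom = (runit A).hom ≫ f :=
  hom_ext <| op_ext fun S c => by
    simp only [linMap_tensorMor, linMap_comp, LinearMap.comp_apply, linMap_runit, linMap_id,
      LinearMap.id_apply, map_smul]

theorem tensor_pentagon (A B C D : Quant) :
    tensorMor (assoc A B C).hom (𝟙 D) ≫ (assoc A (tensor B C) D).hom ≫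
        tensorMor (𝟙 A) (assoc B C D).hom =
      (assoc (tensor A B) C D).hom ≫ (assoc A B (tensor C D)).hom :=
  hom_ext <| op_ext₄ fun S T U V => by
    simp only [linMap_tensorMor, linMap_comp, LinearMap.comp_apply, linMap_assoc, linMap_id,
      LinearMap.id_apply]

theorem tensor_triangle (A B : Quant) :
    (assoc A unit B).hom ≫ tensorMor (𝟙 A) (lunit B).hom = tensorMor (runit A).hom (𝟙 B) :=
  hom_ext <| op_ext₃ fun S c T => by
    simp only [linMap_tensorMor, linMap_comp, LinearMap.comp_apply, linMap_assoc, linMap_id,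
      LinearMap.id_apply, linMap_lunit, linMap_runit, smul_tmulOp,
      tmulOp_smul]

theorem swap_naturality_right (A : Quant) (f : B ⟶ C) :
    whiskerL A f ≫ (swap A C).hom = (swap A B).hom ≫ whiskerR f A :=
  hom_ext <| op_ext fun S T => by
    simp only [linMap_swap, linMap_whiskerL, linMap_whiskerR, linMap_comp, LinearMap.comp_apply]

theorem swap_naturality_left (f : A ⟶ B) (C : Quant) :
    whiskerR f C ≫ (swap B C).hom = (swap A C).hom ≫ whiskerL C f :=
  hom_ext <| op_ext fun S T => by
    simp only [linMap_swap, linMap_whiskerL, linMap_whiskerR, linMap_comp, LinearMap.comp_apply]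

theorem swap_symmetry (A B : Quant) : (swap A B).hom ≫ (swap B A).hom = 𝟙 (tensor A B) :=
  hom_ext <| op_ext fun S T => by
    simp only [linMap_swap, linMap_comp, LinearMap.comp_apply, linMap_id, LinearMap.id_apply]

theorem swap_hexagon (A B C : Quant) :
    (assoc A B C).hom ≫ (swap A (tensor B C)).hom ≫ (assoc B C A).hom =
      whiskerR (swap A B).hom C ≫ (assoc B A C).hom ≫ whiskerL B (swap A C).hom :=
  hom_ext <| op_ext₃ fun S T U => by
    simp only [linMap_swap, linMap_whiskerL, linMap_whiskerR, linMap_assoc, linMap_comp,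
      LinearMap.comp_apply]

theorem swap_hexagon' (A B C : Quant) :
    (assoc A B C).inv ≫ (swap (tensor A B) C).hom ≫ (assoc C A B).inv =
      whiskerL A (swap B C).hom ≫ (assoc A C B).inv ≫ whiskerR (swap A C).hom B := by
  rw [← Iso.cancel_iso_hom_left (assoc A B C), Iso.hom_inv_id_assoc]
  refine hom_ext <| op_ext₃ fun S T U => ?_
  simp only [linMap_swap, linMap_whiskerL, linMap_whiskerR, linMap_assoc, linMap_comp,
      LinearMap.comp_apply, linMap_assoc_inv]

end Coherence

noncomputable instance : MonoidalCategoryStruct Quant where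
  tensorObj := tensor
  whiskerLeft L _ _ f := whiskerL L f
  whiskerRight f L := whiskerR f L
  tensorHom f g := tensorMor f g
  tensorUnit := unit
  associator := assoc
  leftUnitor := lunit
  rightUnitor := runit

noncomputable instance : MonoidalCategory Quant :=
  MonoidalCategory.ofTensorHom
    (id_tensorHom_id := tensorMor_id)
    (id_tensorHom := fun _ _ _ f => id_tensorMor f)
    (tensorHom_id := fun f _ => tensorMor_id_right f)
    (tensorHom_comp_tensorHom := tensorMor_comp)
    (associator_naturality := assoc_naturality)
    (leftUnitor_naturality := lunit_naturality)
    (rightUnitor_naturality := runit_naturality)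
    (pentagon := tensor_pentagon)
    (triangle := tensor_triangle)

noncomputable instance : SymmetricCategory Quant where
  braiding := swap
  braiding_naturality_right A _ _ f := swap_naturality_right A f
  braiding_naturality_left f C := swap_naturality_left f C
  hexagon_forward := swap_hexagon
  hexagon_reverse := swap_hexagon'
  symmetry := swap_symmetry

/-- The completely mixed state of `A`: the completely positive map `B(ℂ) → B(A)` whose value at
`1` is the density matrix `id_A`. -/
noncomputable def mixedState (A : Quant) : 𝟙_ Quant ⟶ A :=
  ofStarHom (A := unit)
    { toFun := fun c => c 1 • (1 : A.Op)
      map_smul' := fun r c => by simp [mul_smul]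
      map_zero' := by simp
      map_add' := fun c d => by simp [add_smul]
      map_mul' := fun c d => by
        have h : c (d 1) = c 1 * d 1 := by
          have := c.map_smul (d 1) 1
          rwa [smul_eq_mul, mul_one, smul_eq_mul, mul_comm] at this
        rw [smul_mul_smul_comm, one_mul, mul_apply_eq_comp, h]
      map_star' := fun c => by
        have h : (star c) 1 = star (c 1) := by
          have := ContinuousLinearMap.adjoint_inner_right c (1 : ℂ) (1 : ℂ)
          simpa [ContinuousLinearMap.star_eq_adjoint] using this
        rw [h, star_smul, star_one] }

theorem linMap_mixedState (A : Quant) (c : unit.Op) :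
    linMap (mixedState A) c = c 1 • (1 : A.Op) := rfl

end Quant

section Lifting

universe v u

variable {𝒞 : Type u} [Category.{v} 𝒞] [MonoidalCategory 𝒞]

/-- The relation `f ⊘ g`: every `f ⊗ id_A` has the left lifting property with respect to every
`g ⊗ id_B`. -/
def StableLift {X Y Z W : 𝒞} (f : X ⟶ Y) (g : Z ⟶ W) : Prop :=
  ∀ A B : 𝒞, HasLiftingProperty (f ▷ A) (g ▷ B)

/-- The class `𝒜^⊘` of morphisms `g` with `f ⊘ g` for all `f ∈ 𝒜`. -/
def stableRightLift (𝒜 : MorphismProperty 𝒞) : MorphismProperty 𝒞 :=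
  fun _ _ g => ∀ ⦃X Y : 𝒞⦄ (f : X ⟶ Y), 𝒜 f → StableLift f g

/-- The class `^⊘𝒜` of morphisms `f` with `f ⊘ g` for all `g ∈ 𝒜`. -/
def stableLeftLift (𝒜 : MorphismProperty 𝒞) : MorphismProperty 𝒞 :=
  fun _ _ f => ∀ ⦃Z W : 𝒞⦄ (g : Z ⟶ W), 𝒜 g → StableLift f g

/-- Given a family `μ` of completely mixed states, the pure morphisms `𝒫 = ℳ₀^⊘`, where `ℳ₀` is
the collection of all completely mixed states. -/
def pureMorphisms (μ : ∀ A : 𝒞, 𝟙_ 𝒞 ⟶ A) : MorphismProperty 𝒞 :=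
  stableRightLift (MorphismProperty.ofHoms μ)

/-- The mixing morphisms `ℳ = ^⊘𝒫`. -/
def mixingMorphisms (μ : ∀ A : 𝒞, 𝟙_ 𝒞 ⟶ A) : MorphismProperty 𝒞 :=
  stableLeftLift (pureMorphisms μ)

/-- The simple mixing maps: the morphisms `A ⟶ B` of the form `p ∘ (id_A ⊗ μ_C)` with
`p : A ⊗ C ⟶ B` an isomorphism (up to the unitor `A ≅ A ⊗ I`). -/
def simpleMixingMaps (μ : ∀ A : 𝒞, 𝟙_ 𝒞 ⟶ A) : MorphismProperty 𝒞 :=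
  fun A B m => ∃ (C : 𝒞) (p : A ⊗ C ⟶ B), IsIso p ∧ m = (ρ_ A).inv ≫ (A ◁ μ C) ≫ p

end Lifting

/-! That simple mixing maps are mixing is formal: tensored with any object, such a map is a map `μ_C
▷ _` composed with isomorphisms, so it lifts against every pure map.

For the converse, the pure maps needed are the conjugations `W X W†`. Every completely positive map
has a dilation `ρ ↦ K (ρ ⊗ 1) K†` (`exists_eq_mix_comp_conj`), and two dilations `V`, `W` of one map
are related by operators `U`, `N` on the environments with `V (1 ⊗ U) = W`, `V (1 ⊗ N) = 0` and `U
U† + N N† = 1` (`exists_intertwiner`). In a square from a completely mixed state to a conjugation,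
dilating both horizontal sides gives two dilations of the diagonal; `U` and `N` provide the two
summands of a lift. Hence conjugations are pure (`pureMorphisms_conj`).

Now let `f` be mixing. It is nonzero, so it has a dilation `K` with environment `E` in which no
nonzero vector of `E` is invisible to `K`. Lifting `f` against `conj K` gives `h` with `f ≫ h = mix
A E` and `h ≫ conj K = 𝟙`. Dilate `h` by `H` with environment `G`. Uniqueness of dilations, applied
to each equation, gives `K H (y ⊗ g) = u(g) y` and `H (K (x ⊗ e) ⊗ g) = x ⊗ T (e ⊗ g)`. Minimality
forces `T (e ⊗ g) = u(g) e`, so for `u(g) ≠ 0` the operator `u(g)⁻¹ H (- ⊗ g)` is a two-sided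
inverse of `K`, and `conj K` is an isomorphism. -/

namespace Quant

open ContinuousLinearMap InnerProductSpace TensorProduct

/-! ### Families of vectors with equal Gram matrices -/

section Gram

variable {E F : Type*} [NormedAddCommGroup E] [InnerProductSpace ℂ E] [FiniteDimensional ℂ E]
  [CompleteSpace E] [NormedAddCommGroup F] [InnerProductSpace ℂ F] [CompleteSpace F]

/-- Two families of vectors with the same Gram matrix are related by a partial isometry `U†`;
the operator `N` completes `U` to a resolution of the identity. -/
theorem exists_partialIsometry_of_gram_eq {ι : Type*} (t : ι → E) (s : ι → F)
    (h : ∀ i j, ⟪t i, t j⟫_ℂ = ⟪s i, s j⟫_ℂ) :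
    ∃ (U : F →L[ℂ] E) (N : E →L[ℂ] E), (∀ i, adjoint U (t i) = s i) ∧
      (∀ i, adjoint N (t i) = 0) ∧ U ∘L adjoint U + N ∘L adjoint N = 1 := by
  let L₁ : (ι →₀ ℂ) →ₗ[ℂ] E := Finsupp.linearCombination ℂ t
  let L₂ : (ι →₀ ℂ) →ₗ[ℂ] F := Finsupp.linearCombination ℂ s
  have hL : ∀ x y, ⟪L₁ x, L₁ y⟫_ℂ = ⟪L₂ x, L₂ y⟫_ℂ := fun x y => by
    simp only [L₁, L₂, Finsupp.linearCombination_apply, Finsupp.sum, sum_inner, inner_sum,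
      inner_smul_left, inner_smul_right, h]
  obtain ⟨R, hR⟩ := L₁.rangeRestrict.exists_rightInverse_of_surjective L₁.range_rangeRestrict
  have hR' : ∀ z, L₁ (R z) = z := fun z => congrArg Subtype.val (LinearMap.congr_fun hR z)
  have hker : ∀ x, L₁ x = 0 → L₂ x = 0 := fun x hx => by
    rw [← inner_self_eq_zero (𝕜 := ℂ), ← hL, hx, inner_zero_left]
  let P := L₁.range.orthogonalProjectionOnto
  -- Send `L₁ x` to `L₂ x` and the orthogonal complement of the range to zero. Equality of the Gram
  -- matrices makes this independent of the section `R` and isometric on the range of `L₁`.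
  let S : E →L[ℂ] F := LinearMap.toContinuousLinearMap (L₂ ∘ₗ R ∘ₗ P.toLinearMap)
  have hS : ∀ x, S (L₁ x) = L₂ x := fun x => by
    have h1 : P (L₁ x) = ⟨L₁ x, x, rfl⟩ :=
      Submodule.orthogonalProjectionOnto_mem_subspace_eq_self (⟨L₁ x, x, rfl⟩ : L₁.range)
    change L₂ (R (P (L₁ x))) = _
    rw [h1, ← sub_eq_zero, ← map_sub]
    exact hker _ (by rw [map_sub, hR', sub_self])
  have hSS : adjoint S ∘L S = L₁.range.starProjection := by
    ext x
    refine ext_inner_left ℂ fun y => ?_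
    rw [ContinuousLinearMap.comp_apply, adjoint_inner_right]
    change ⟪L₂ (R (P y)), L₂ (R (P x))⟫_ℂ = _
    rw [← hL, hR', hR']
    change ⟪L₁.range.starProjection y, L₁.range.starProjection x⟫_ℂ = _
    rw [Submodule.inner_starProjection_left_eq_right,
      Submodule.starProjection_eq_self_iff.mpr (Submodule.starProjection_apply_mem _ x)]
  refine ⟨adjoint S, 1 - L₁.range.starProjection, fun i => ?_, fun i => ?_, ?_⟩
  · have := hS (Finsupp.single i 1)
    simpa [L₁, L₂] using this
  · have : L₁.range.starProjection (t i) = t i :=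
      Submodule.starProjection_eq_self_iff.mpr ⟨Finsupp.single i 1, by simp [L₁]⟩
    rw [(IsStarProjection.one_sub (isStarProjection_starProjection)).isSelfAdjoint.adjoint_eq]
    simp [this]
  · have hQ : IsStarProjection (1 - L₁.range.starProjection) :=
      IsStarProjection.one_sub isStarProjection_starProjection
    rw [adjoint_adjoint, hSS, hQ.isSelfAdjoint.adjoint_eq]
    have := hQ.isIdempotentElem.eq
    rw [← mul_def, this, add_sub_cancel]

end Gram

/-! ### Uniqueness of dilations -/

variable {A B C X Y : Quant}

instance (A B : Quant) : CompleteSpace (A ⊗[ℂ] B) := FiniteDimensional.complete ℂ _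

theorem mkL_adjoint_tmul (x a : A) (e : B) :
    adjoint (mkL ℂ A B x) (a ⊗ₜ[ℂ] e) = ⟪x, a⟫_ℂ • e :=
  ext_inner_left ℂ fun v => by
    rw [adjoint_inner_right, inner_smul_right, mkL_apply_apply, inner_tmul]

theorem mkL_comp_adjoint_mkL (x x' : A) :
    (mkL ℂ A B x ∘L adjoint (mkL ℂ A B x') : (tensor A B).Op) = tmulOp (rankOne ℂ x x') 1 := by
  refine ContinuousLinearMap.coe_injective (TensorProduct.ext' fun a e => ?_)
  change mkL ℂ A B x (adjoint (mkL ℂ A B x') (a ⊗ₜ[ℂ] e)) = (rankOne ℂ x x') a ⊗ₜ[ℂ] e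
  rw [mkL_adjoint_tmul, rankOne_apply, mkL_apply_apply, TensorProduct.smul_tmul]

/-- Uniqueness of dilations of a completely positive map. -/
theorem exists_intertwiner {E F : Quant} (V : tensor A E →L[ℂ] Y) (W : tensor A F →L[ℂ] Y)
    (h : ∀ ρ : A.Op, V ∘L tmulOp ρ 1 ∘L adjoint V = W ∘L tmulOp ρ 1 ∘L adjoint W) :
    ∃ (U : F →L[ℂ] E) (N : E →L[ℂ] E), V ∘L mapL (.id ℂ A) U = W ∧
      V ∘L mapL (.id ℂ A) N = 0 ∧ U ∘L adjoint U + N ∘L adjoint N = 1 := by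
  -- With `V_x = V (x ⊗ -)`, the Gram matrix of the vectors `V_x† y` has entries `⟪y, V (|x⟩⟨x'| ⊗
  -- 1) V† y'⟫`, which depend only on the completely positive map that `V` dilates.
  let t (p : A × Y) : E := adjoint (V ∘L mkL ℂ A E p.1) p.2
  let s (p : A × Y) : F := adjoint (W ∘L mkL ℂ A F p.1) p.2
  obtain ⟨U, N, hU, hN, hUN⟩ := exists_partialIsometry_of_gram_eq t s fun p q => by
    have key : ∀ {G : Quant} (Z : tensor A G →L[ℂ] Y),
        ⟪adjoint (Z ∘L mkL ℂ A G p.1) p.2, adjoint (Z ∘L mkL ℂ A G q.1) q.2⟫_ℂ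
          = ⟪p.2, (Z ∘L tmulOp (rankOne ℂ p.1 q.1) 1 ∘L adjoint Z) q.2⟫_ℂ := fun Z => by
      rw [adjoint_inner_left, ← mkL_comp_adjoint_mkL, adjoint_comp]
      rfl
    simp only [t, s, key, h]
  refine ⟨U, N, ?_, ?_, hUN⟩
  · refine ContinuousLinearMap.coe_injective (TensorProduct.ext' fun x v => ?_)
    refine ext_inner_left ℂ fun y => ?_
    change ⟪y, (V ∘L mkL ℂ A E x) (U v)⟫_ℂ = ⟪y, (W ∘L mkL ℂ A F x) v⟫_ℂ
    rw [← adjoint_inner_left, ← adjoint_inner_left U, ← adjoint_inner_left]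
    exact congrArg (⟪·, v⟫_ℂ) (hU (x, y))
  · refine ContinuousLinearMap.coe_injective (TensorProduct.ext' fun x v => ?_)
    refine ext_inner_left ℂ fun y => ?_
    change ⟪y, (V ∘L mkL ℂ A E x) (N v)⟫_ℂ = ⟪y, 0⟫_ℂ
    rw [← adjoint_inner_left, ← adjoint_inner_left N, inner_zero_right]
    exact (congrArg (⟪·, v⟫_ℂ) (hN (x, y))).trans (inner_zero_left _)

/-! ### Conjugations and adjunction of completely mixed systems -/

/-- Conjugation `X ↦ V X V†` by an operator `V : A → B`. -/
noncomputable def conj (V : A →L[ℂ] B) : A ⟶ B :=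
  Hom.ofLinear
    { toFun := fun S => V ∘L S ∘L adjoint V
      map_add' := fun S T => by simp
      map_smul' := fun c S => by simp }
    fun k M hM => by
      rw [CStarMatrix.nonneg_iff_sum_inner] at hM ⊢
      intro x
      refine (hM fun i => adjoint V (x i)).trans_eq ?_
      simp [adjoint_inner_left]

theorem linMap_conj (V : A →L[ℂ] B) (S : A.Op) : linMap (conj V) S = V ∘L S ∘L adjoint V := rfl

theorem conj_comp_conj (V : A →L[ℂ] B) (W : B →L[ℂ] C) : conj V ≫ conj W = conj (W ∘L V) := by
  ext1; ext1 S
  simp only [linMap_comp, LinearMap.comp_apply, linMap_conj, adjoint_comp]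
  rfl

theorem conj_id (A : Quant) : conj (.id ℂ A) = 𝟙 A := by
  ext1; ext1 S
  simp only [linMap_conj, linMap_id, LinearMap.id_apply, adjoint_id]
  rfl

/-- Conjugations are closed under tensoring with identities, so a plain lifting property against all
conjugations is automatically stable on that side. -/
theorem conj_whiskerRight (V : A →L[ℂ] B) (L : Quant) :
    conj V ▷ L = conj (A := A ⊗ L) (B := B ⊗ L) (mapL V (.id ℂ L)) := by
  refine hom_ext (op_ext fun S T => ?_)
  refine (linMap_whiskerR (conj V) L S T).trans ?_
  change mapL (V ∘L S ∘L adjoint V) T = mapL V (.id ℂ L) ∘L mapL S T ∘L adjoint (mapL V (.id ℂ L))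
  rw [adjoint_mapL, ← mapL_comp, ← mapL_comp, adjoint_id, id_comp, comp_id]

/-- Adjoining a completely mixed system: `ρ ↦ ρ ⊗ 1`. -/
noncomputable def mix (A C : Quant) : A ⟶ A ⊗ C := (ρ_ A).inv ≫ A ◁ mixedState C

theorem linMap_runit_inv (S : A.Op) : linMap (runit A).inv S = tmulOp S 1 := by
  have h := linMap_runit S (1 : unit.Op)
  rw [show (1 : unit.Op) 1 = 1 from rfl, one_smul] at h
  conv_lhs => rw [← h]
  exact LinearMap.congr_fun (congrArg linMap (runit A).hom_inv_id) _

theorem linMap_lunit_inv (S : A.Op) : linMap (lunit A).inv S = tmulOp 1 S := by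
  have h := linMap_lunit (1 : unit.Op) S
  rw [show (1 : unit.Op) 1 = 1 from rfl, one_smul] at h
  conv_lhs => rw [← h]
  exact LinearMap.congr_fun (congrArg linMap (lunit A).hom_inv_id) _

theorem linMap_mix (S : A.Op) : linMap (mix A C) S = tmulOp S 1 := by
  change linMap (whiskerL A (mixedState C)) (linMap (runit A).inv S) = _
  rw [linMap_runit_inv, linMap_whiskerL, linMap_mixedState, show (1 : unit.Op) 1 = 1 from rfl,
    one_smul]

theorem linMap_mixedState_whiskerRight (S : A.Op) :
    linMap ((λ_ A).inv ≫ mixedState C ▷ A) S = tmulOp 1 S := by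
  change linMap (whiskerR (mixedState C) A) (linMap (lunit A).inv S) = _
  rw [linMap_lunit_inv, linMap_whiskerR, linMap_mixedState, show (1 : unit.Op) 1 = 1 from rfl,
    one_smul]

/-! ### Existence of dilations and of minimal ones -/

theorem op_ext_rankOne {ι : Type*} [Fintype ι] (e : OrthonormalBasis ι ℂ A) {V : Type*}
    [AddCommGroup V] [Module ℂ V] {f g : A.Op →ₗ[ℂ] V}
    (h : ∀ i j, f (rankOne ℂ (e i) (e j)) = g (rankOne ℂ (e i) (e j))) : f = g := by
  ext S
  have hS : S = ∑ j, ∑ i, ⟪e i, S (e j)⟫_ℂ • rankOne ℂ (e i) (e j) := by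
    ext x
    simp only [sum_apply, smul_apply, rankOne_apply]
    conv_lhs => rw [← e.sum_repr' x, map_sum]
    refine Finset.sum_congr rfl fun j _ => ?_
    rw [map_smul]
    conv_lhs => rw [← e.sum_repr' (S (e j)), Finset.smul_sum]
    exact Finset.sum_congr rfl fun i _ => smul_comm _ _ _
  rw [hS]
  simp only [map_sum, map_smul, h]

/-- Every completely positive map is the adjunction of a completely mixed system followed by a
conjugation. -/
theorem exists_eq_mix_comp_conj (f : A ⟶ B) :
    ∃ (E : Quant) (K : tensor A E →L[ℂ] B), f = mix A E ≫ conj (A := A ⊗ E) K := by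
  let e := stdOrthonormalBasis ℂ A
  -- The Choi argument: the matrix of matrix units is positive, so its image under `f` has the form
  -- `b† b`.
  let M : CStarMatrix (Fin (Module.finrank ℂ A)) (Fin (Module.finrank ℂ A)) A.Op :=
    CStarMatrix.ofMatrix fun i j => rankOne ℂ (e i) (e j)
  have hM : 0 ≤ M := by
    rw [CStarMatrix.nonneg_iff_sum_inner]
    intro x
    have : ∑ i, ∑ j, ⟪x i, M i j (x j)⟫_ℂ
        = star (∑ i, ⟪e i, x i⟫_ℂ) * ∑ j, ⟪e j, x j⟫_ℂ := by
      rw [star_sum, Finset.sum_mul_sum]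
      refine Finset.sum_congr rfl fun i _ => Finset.sum_congr rfl fun j _ => ?_
      change ⟪x i, rankOne ℂ (e i) (e j) (x j)⟫_ℂ = _
      rw [rankOne_apply, inner_smul_right, mul_comm]
      congr 1
      exact (inner_conj_symm _ _).symm
    rw [this]
    exact star_mul_self_nonneg _
  obtain ⟨b, hb⟩ := (CStarMatrix.nonneg_iff_star_mul_self_aux _).mp (Hom.nonneg f M hM)
  have hb' : ∀ i j, linMap f (rankOne ℂ (e i) (e j)) = ∑ k, adjoint (b k i) ∘L b k j :=
    fun i j => by
    have := congrArg (fun N : CStarMatrix _ _ B.Op => N i j) hb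
    simp only [CStarMatrix.mul_apply, CStarMatrix.star_apply] at this
    exact this
  -- `y ↦ ∑ e_i ⊗ (e_k ⊗ b_ki y)`. The second copy of `A` only records the summation index `k` of
  -- the product `b† b`.
  let K : B →L[ℂ] tensor A (tensor A B) :=
    ∑ i, ∑ k, mkL ℂ A (tensor A B) (e i) ∘L mkL ℂ A B (e k) ∘L b k i
  refine ⟨tensor A B, adjoint K, hom_ext (op_ext_rankOne e fun i j => ?_)⟩
  rw [hb', linMap_comp, LinearMap.comp_apply, linMap_mix, linMap_conj, adjoint_adjoint]
  have hK : ∀ (i : Fin (Module.finrank ℂ A)), adjoint (mkL ℂ A (tensor A B) (e i)) ∘L K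
      = ∑ k, mkL ℂ A B (e k) ∘L b k i := fun i => by
    ext y
    simp only [K, ContinuousLinearMap.comp_apply, sum_apply, map_sum]
    rw [Finset.sum_eq_single i]
    · refine Finset.sum_congr rfl fun k _ => ?_
      refine (mkL_adjoint_tmul (B := tensor A B) _ _ _).trans ?_
      rw [inner_self_eq_norm_sq_to_K, e.norm_eq_one]
      simp
    · intro i' _ hi'
      refine Finset.sum_eq_zero fun k _ => ?_
      refine (mkL_adjoint_tmul (B := tensor A B) _ _ _).trans ?_
      rw [e.inner_eq_zero hi'.symm, zero_smul]
    · simp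
  rw [← mkL_comp_adjoint_mkL]
  ext y
  refine ext_inner_left ℂ fun z => ?_
  change _ = ⟪z, adjoint K (mkL ℂ A (tensor A B) (e i)
    ((adjoint (mkL ℂ A (tensor A B) (e j)) ∘L K) y))⟫_ℂ
  rw [adjoint_inner_right, ← adjoint_inner_left (mkL ℂ A (tensor A B) (e i))]
  change _ = ⟪(adjoint (mkL ℂ A (tensor A B) (e i)) ∘L K) z, _⟫_ℂ
  rw [hK, hK]
  simp only [sum_apply, ContinuousLinearMap.comp_apply, inner_sum, sum_inner, adjoint_inner_right,
    mkL_apply_apply, inner_tmul]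
  refine Finset.sum_congr rfl fun k _ => ?_
  rw [Finset.sum_eq_single k]
  · simp
  · intro k' _ hk'
    rw [e.inner_eq_zero hk', zero_mul]
  · simp

theorem linMap_mix_comp_conj {E : Quant} (K : tensor A E →L[ℂ] B) (S : A.Op) :
    linMap (mix A E ≫ conj (A := A ⊗ E) K) S = K ∘L tmulOp S 1 ∘L adjoint K := by
  rw [linMap_comp, LinearMap.comp_apply, linMap_mix, linMap_conj]

/-- Acting by `U` on the environment replaces the inserted `1` by `U U†`; this is how a resolution
`U U† + N N† = 1` splits a map into two summands. -/
theorem conj_tmulOp_comp_mapL {E F : Quant} (K : tensor A E →L[ℂ] B) (U : F →L[ℂ] E) (S : A.Op) :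
    ((K ∘L mapL (.id ℂ A) U : tensor A F →L[ℂ] B) ∘L tmulOp S 1 ∘L
        adjoint (K ∘L mapL (.id ℂ A) U : tensor A F →L[ℂ] B)) =
      K ∘L tmulOp S (U ∘L adjoint U) ∘L adjoint K := by
  have h : mapL (.id ℂ A) U ∘L mapL S (1 : F.Op) ∘L adjoint (mapL (.id ℂ A) U)
      = mapL S (U ∘L adjoint U) := by
    rw [adjoint_mapL, ← mapL_comp, ← mapL_comp, adjoint_id, id_comp, comp_id]
    rfl
  change _ = K ∘L mapL S (U ∘L adjoint U) ∘L adjoint K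
  rw [← h, adjoint_comp]
  rfl

/-- The environment vectors `v` with `K (- ⊗ v) = 0` contribute nothing, so the environment can be
cut down to their orthogonal complement. It is a nonzero space, hence an object, because the map is
nonzero. -/
theorem exists_minimal_dilation (f : A ⟶ B) (hf : linMap f ≠ 0) :
    ∃ (E : Quant) (K : tensor A E →L[ℂ] B), f = mix A E ≫ conj (A := A ⊗ E) K ∧
      ∀ v : E, (∀ x : A, K (x ⊗ₜ[ℂ] v) = 0) → v = 0 := by
  obtain ⟨E, K, rfl⟩ := exists_eq_mix_comp_conj f
  let S : Submodule ℂ E :=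
    { carrier := {v | ∀ x : A, K (x ⊗ₜ[ℂ] v) = 0}
      add_mem' := fun {v w} hv hw x => by
        rw [tmul_add, map_add, hv x, hw x, add_zero]
      zero_mem' := fun x => by rw [tmul_zero, map_zero]
      smul_mem' := fun c v hv x => by
        rw [tmul_smul]
        exact (K.map_smul c _).trans (by rw [hv x, smul_zero]) }
  have hnt : Nontrivial Sᗮ := by
    rw [Submodule.nontrivial_iff_ne_bot, Ne, Submodule.orthogonal_eq_bot_iff]
    intro hS
    have hK : K = 0 := ContinuousLinearMap.coe_injective (TensorProduct.ext' fun x v =>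
      (hS ▸ Submodule.mem_top : v ∈ S) x)
    refine hf (LinearMap.ext fun ρ => ?_)
    rw [linMap_mix_comp_conj, hK, zero_comp]
    rfl
  let E' : Quant := ⟨Sᗮ⟩
  let i : E' →L[ℂ] E := Sᗮ.subtypeL
  have hi : i ∘L adjoint i = Sᗮ.starProjection := by
    have : adjoint i = Sᗮ.orthogonalProjectionOnto := Sᗮ.adjoint_subtypeL
    rw [this]
    rfl
  have hP : IsStarProjection Sᗮ.starProjection := isStarProjection_starProjection
  have hKP : K ∘L mapL (.id ℂ A) Sᗮ.starProjection = K := by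
    refine ContinuousLinearMap.coe_injective (TensorProduct.ext' fun x v => ?_)
    change K (x ⊗ₜ[ℂ] Sᗮ.starProjection v) = K (x ⊗ₜ[ℂ] v)
    have hv : v - Sᗮ.starProjection v ∈ S := by
      have := Sᗮ.sub_starProjection_mem_orthogonal v
      rwa [Submodule.orthogonal_orthogonal] at this
    have := hv x
    rw [tmul_sub, map_sub, sub_eq_zero] at this
    exact this.symm
  refine ⟨E', K ∘L mapL (.id ℂ A) i, hom_ext (LinearMap.ext fun ρ => ?_), fun v hv => ?_⟩
  · rw [linMap_mix_comp_conj, linMap_mix_comp_conj, conj_tmulOp_comp_mapL, hi]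
    have h := conj_tmulOp_comp_mapL K Sᗮ.starProjection ρ
    rw [hKP, hP.isSelfAdjoint.adjoint_eq, ← mul_def, hP.isIdempotentElem.eq] at h
    exact h
  · refine Subtype.ext ?_
    have hvS : (v : E) ∈ S := hv
    exact inner_self_eq_zero.mp (Submodule.inner_right_of_mem_orthogonal hvS v.2)

/-! ### Completely mixed states lift against conjugations -/

/-- The sum of two completely positive maps. -/
noncomputable def add (f g : A ⟶ B) : A ⟶ B :=
  Hom.ofLinear (linMap f + linMap g) fun _ M hM =>
    add_nonneg (Hom.nonneg f M hM) (Hom.nonneg g M hM)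

theorem linMap_add (f g : A ⟶ B) : linMap (add f g) = linMap f + linMap g := rfl

theorem add_comp (f g : A ⟶ B) (h : B ⟶ C) : add f g ≫ h = add (f ≫ h) (g ≫ h) := by
  ext1; ext1 S
  simp only [linMap_comp, linMap_add, LinearMap.comp_apply, LinearMap.add_apply, map_add]

theorem comp_add (f : A ⟶ B) (g h : B ⟶ C) : f ≫ add g h = add (f ≫ g) (f ≫ h) := rfl

theorem linMap_conj_zero : linMap (conj (0 : A →L[ℂ] B)) = 0 := by
  ext1 S
  rw [linMap_conj, zero_comp]
  rfl

/-- The unitary `A ⊗ (C ⊗ F) ≃ (C ⊗ A) ⊗ F`. -/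
noncomputable def shuffle (A C F : Quant) :
    tensor A (tensor C F) ≃ₗᵢ[ℂ] tensor (tensor C A) F :=
  (TensorProduct.assocIsometry ℂ A C F).symm.trans
    (LinearIsometryEquiv.rTensor F (TensorProduct.commIsometry ℂ A C))

theorem shuffle_comp_tmulOp {F : Quant} (S : A.Op) :
    (shuffle A C F : tensor A (tensor C F) →L[ℂ] tensor (tensor C A) F) ∘L tmulOp S 1 =
      tmulOp (tmulOp 1 S) 1 ∘L (shuffle A C F : _ →L[ℂ] _) := by
  refine ContinuousLinearMap.coe_injective (TensorProduct.ext' fun a x => ?_)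
  induction x using TensorProduct.induction_on with
  | zero => rw [tmul_zero, map_zero, map_zero]
  | add x y hx hy => rw [tmul_add, map_add, map_add, hx, hy]
  | tmul c v => rfl

/-- Used for unitaries that rebracket or permute tensor factors: precomposing a dilation with one
does not change the dilated map. -/
theorem conj_comp_of_intertwines (s : X →L[ℂ] Y) {S : X.Op} {T : Y.Op} (h : s ∘L S = T ∘L s)
    (hs : s ∘L adjoint s = .id ℂ Y) (K : Y →L[ℂ] B) :
    (K ∘L s) ∘L S ∘L adjoint (K ∘L s) = K ∘L T ∘L adjoint K := by
  rw [adjoint_comp]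
  calc (K ∘L s) ∘L S ∘L adjoint s ∘L adjoint K
      = K ∘L (s ∘L S) ∘L adjoint s ∘L adjoint K := rfl
    _ = K ∘L T ∘L (s ∘L adjoint s) ∘L adjoint K := by rw [h]; rfl
    _ = K ∘L T ∘L adjoint K := by rw [hs, id_comp]

theorem isometryEquiv_comp_adjoint (e : X ≃ₗᵢ[ℂ] Y) :
    (e : X →L[ℂ] Y) ∘L adjoint (e : X →L[ℂ] Y) = .id ℂ Y := by
  rw [LinearIsometryEquiv.adjoint_eq_symm]
  ext x
  exact e.apply_symm_apply x

theorem conj_shuffle {F : Quant} (K : tensor (tensor C A) F →L[ℂ] B) (S : A.Op) :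
    ((K ∘L (shuffle A C F : tensor A (tensor C F) →L[ℂ] tensor (tensor C A) F)) ∘L tmulOp S 1 ∘L
        adjoint (K ∘L (shuffle A C F : tensor A (tensor C F) →L[ℂ] tensor (tensor C A) F))) =
      K ∘L tmulOp (tmulOp 1 S) 1 ∘L adjoint K :=
  conj_comp_of_intertwines _ (shuffle_comp_tmulOp S) (isometryEquiv_comp_adjoint _) K

theorem hasLiftingProperty_mixedState_conj (C A : Quant) (W : X →L[ℂ] Y) :
    HasLiftingProperty (mixedState C ▷ A) (conj W) := by
  refine ⟨fun {a b} sq => ?_⟩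
  obtain ⟨E, K, hK⟩ := exists_eq_mix_comp_conj ((λ_ A).inv ≫ a)
  obtain ⟨F, H, hH⟩ := exists_eq_mix_comp_conj b
  let s : tensor A (tensor C F) →L[ℂ] tensor (tensor C A) F := shuffle A C F
  let s' : tensor (tensor C A) F →L[ℂ] tensor A (tensor C F) := (shuffle A C F).symm
  have hss' : s ∘L s' = .id ℂ _ := by ext x; exact (shuffle A C F).apply_symm_apply x
  have hs's : s' ∘L s = .id ℂ _ := by ext x; exact (shuffle A C F).symm_apply_apply x
  have hb : ∀ ρ : A.Op, linMap ((λ_ A).inv ≫ mixedState C ▷ A ≫ b) ρ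
      = H ∘L tmulOp (tmulOp 1 ρ) 1 ∘L adjoint H := fun ρ => by
    rw [← Category.assoc, linMap_comp, LinearMap.comp_apply, linMap_mixedState_whiskerRight, hH]
    exact linMap_mix_comp_conj H _
  -- Both operators dilate the diagonal `A → Y` of the square: one through the top side with
  -- environment `E`, the other through the bottom side with environment `C ⊗ F`.
  obtain ⟨U, N, hU, hN, hUN⟩ := exists_intertwiner (W ∘L K) (H ∘L s) fun ρ => by
    rw [conj_shuffle, ← hb, ← sq.w, ← Category.assoc, hK, Category.assoc, conj_comp_conj]
    exact (linMap_mix_comp_conj _ _).symm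
  obtain ⟨c, hc⟩ := exists_norm_eq C zero_le_one
  -- `⟨c| ⊗ 1` for a unit vector `c`, a compression sending `1 ⊗ ρ` back to `ρ`.
  let p : tensor C A →L[ℂ] A := adjoint (mkL ℂ C A c)
  have hp : ∀ ρ : A.Op, p ∘L tmulOp 1 ρ ∘L adjoint p = ρ := fun ρ => by
    ext x
    change p (tmulOp 1 ρ (adjoint p x)) = ρ x
    rw [show adjoint p = mkL ℂ C A c from adjoint_adjoint _]
    refine (mkL_adjoint_tmul c c (ρ x)).trans ?_
    rw [inner_self_eq_norm_sq_to_K, hc]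
    simp
  -- `l₁` is a lift of `b` through `conj W`, but along the mixed state it gives only the `U U†` part
  -- of `a`. `l₂` supplies the missing `N N†` part and is killed by `conj W`, so the lift is the
  -- sum.
  let l₁ : C ⊗ A ⟶ X := mix (C ⊗ A) F ≫ conj (A := (C ⊗ A) ⊗ F) (K ∘L mapL (.id ℂ A) U ∘L s')
  let l₂ : C ⊗ A ⟶ X := conj (A := C ⊗ A) p ≫ mix A E ≫
    conj (A := A ⊗ E) (K ∘L mapL (.id ℂ A) N)
  have h₁ : l₁ ≫ conj W = b := by
    have : W ∘L K ∘L mapL (.id ℂ A) U ∘L s' = H := by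
      calc _ = ((W ∘L K) ∘L mapL (.id ℂ A) U) ∘L s' := rfl
        _ = H ∘L s ∘L s' := by rw [hU]; rfl
        _ = H := by rw [hss', comp_id]
    rw [hH, Category.assoc, conj_comp_conj]
    exact congrArg (fun Z : tensor (tensor C A) F →L[ℂ] Y =>
      mix (C ⊗ A) F ≫ conj (A := (C ⊗ A) ⊗ F) Z) this
  have h₂ : linMap (l₂ ≫ conj W) = 0 := by
    have : W ∘L K ∘L mapL (.id ℂ A) N = 0 := hN
    have h0 : conj (A := A ⊗ E) (K ∘L mapL (.id ℂ A) N) ≫ conj W = conj (A := A ⊗ E) 0 :=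
      (conj_comp_conj _ _).trans (congrArg (fun Z => conj (A := A ⊗ E) Z) this)
    simp only [l₂, Category.assoc, h0]
    rw [linMap_comp, linMap_comp, linMap_conj_zero, LinearMap.zero_comp, LinearMap.zero_comp]
  refine ⟨⟨⟨add l₁ l₂, ?_, ?_⟩⟩⟩
  · rw [← cancel_epi (λ_ A).inv, hK]
    ext1; ext1 ρ
    rw [← Category.assoc, comp_add, linMap_add, LinearMap.add_apply, linMap_comp,
      LinearMap.comp_apply, linMap_comp _ l₂, LinearMap.comp_apply,
      linMap_mixedState_whiskerRight]
    have e₁ : linMap l₁ (tmulOp 1 ρ) = K ∘L tmulOp ρ (U ∘L adjoint U) ∘L adjoint K := by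
      refine (linMap_mix_comp_conj _ _).trans ?_
      rw [← conj_tmulOp_comp_mapL, ← conj_shuffle]
      have : (K ∘L mapL (.id ℂ A) U ∘L s') ∘L s = K ∘L mapL (.id ℂ A) U := by
        calc _ = K ∘L mapL (.id ℂ A) U ∘L (s' ∘L s) := rfl
          _ = _ := by rw [hs's, comp_id]
      exact congrArg (fun Z : tensor A (tensor C F) →L[ℂ] X => Z ∘L tmulOp ρ 1 ∘L adjoint Z) this
    have e₂ : linMap l₂ (tmulOp 1 ρ) = K ∘L tmulOp ρ (N ∘L adjoint N) ∘L adjoint K := by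
      refine (linMap_mix_comp_conj _ _).trans ?_
      rw [← conj_tmulOp_comp_mapL]
      exact congrArg (fun Z : A.Op => (K ∘L mapL (.id ℂ A) N) ∘L tmulOp Z 1 ∘L
        adjoint (K ∘L mapL (.id ℂ A) N)) (hp ρ)
    rw [e₁, e₂, linMap_mix_comp_conj, ← hUN]
    have : tmulOp ρ (U ∘L adjoint U + N ∘L adjoint N)
        = tmulOp ρ (U ∘L adjoint U) + tmulOp ρ (N ∘L adjoint N) := mapL_add_right _ _ _
    rw [this, ContinuousLinearMap.add_comp, ContinuousLinearMap.comp_add]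
  · rw [add_comp]
    refine Eq.trans (hom_ext ?_) h₁
    rw [linMap_add, h₂, add_zero]

theorem pureMorphisms_conj (W : X →L[ℂ] Y) : pureMorphisms mixedState (conj W) := by
  rintro _ _ _ ⟨_⟩ A B
  rw [conj_whiskerRight]
  exact hasLiftingProperty_mixedState_conj _ A _

end Quant

/-! ### The formal inclusion, in any symmetric monoidal category -/

section Lifting

universe v u

variable {𝒞 : Type u} [Category.{v} 𝒞] [MonoidalCategory 𝒞]

theorem StableLift.hasLiftingProperty {X Y Z W : 𝒞} {f : X ⟶ Y} {g : Z ⟶ W}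
    (h : StableLift f g) : HasLiftingProperty f g := by
  have := h (𝟙_ 𝒞) (𝟙_ 𝒞)
  have hf : f = (ρ_ X).inv ≫ f ▷ 𝟙_ 𝒞 ≫ (ρ_ Y).hom := by simp
  have hg : g = (ρ_ Z).inv ≫ g ▷ 𝟙_ 𝒞 ≫ (ρ_ W).hom := by simp
  rw [hf, hg]
  infer_instance

/-- The symmetry and the associator turn `(A ◁ μ C) ▷ A'` into `μ C ▷ (A ⊗ A')`, whose lifting
property is part of the definition of purity. -/
theorem simpleMixingMaps_le_mixingMorphisms [SymmetricCategory 𝒞] (μ : ∀ A : 𝒞, 𝟙_ 𝒞 ⟶ A) :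
    simpleMixingMaps μ ≤ mixingMorphisms μ := by
  rintro A B _ ⟨C, p, hp, rfl⟩ Z W g hg A' B'
  have := hg (μ C) ⟨C⟩ (A ⊗ A') B'
  have h : ((ρ_ A).inv ≫ A ◁ μ C ≫ p) ▷ A' =
      ((ρ_ A).inv ▷ A' ≫ (β_ A (𝟙_ 𝒞)).hom ▷ A' ≫ (α_ _ _ _).hom) ≫ μ C ▷ (A ⊗ A') ≫
        ((α_ _ _ _).inv ≫ (β_ C A).hom ▷ A' ≫ p ▷ A') := by
    have h' : A ◁ μ C = (β_ A (𝟙_ 𝒞)).hom ≫ μ C ▷ A ≫ (β_ C A).hom := by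
      rw [← BraidedCategory.braiding_naturality_right_assoc, SymmetricCategory.symmetry,
        Category.comp_id]
    rw [h']
    simp only [comp_whiskerRight, Category.assoc, whiskerRight_tensor, Iso.hom_inv_id_assoc]
  rw [h]
  infer_instance

end Lifting

/-! ### Mixing morphisms are simple mixing maps -/

namespace Quant

open ContinuousLinearMap InnerProductSpace TensorProduct

variable {A B : Quant}

theorem id_ne_zero (A : Quant) : linMap (𝟙 A) ≠ 0 := fun h =>
  one_ne_zero (LinearMap.congr_fun h (1 : A.Op))

/-- The zero map is a conjugation, hence pure. Lifting a zero `f` against it, with `𝟙 A` on top,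
would factor `𝟙 A` through zero. -/
theorem linMap_ne_zero_of_mixingMorphisms {f : A ⟶ B} (hf : mixingMorphisms mixedState f) :
    linMap f ≠ 0 := fun h0 => by
  have := (hf _ (pureMorphisms_conj (0 : A →L[ℂ] A))).hasLiftingProperty
  have sq : CommSq (𝟙 A) f (conj (0 : A →L[ℂ] A)) (conj (0 : B →L[ℂ] A)) :=
    ⟨hom_ext (by
      rw [linMap_comp, linMap_comp, linMap_conj_zero, linMap_conj_zero, LinearMap.zero_comp,
        LinearMap.zero_comp])⟩
  refine id_ne_zero A ?_
  rw [← sq.fac_left, linMap_comp, h0, LinearMap.comp_zero]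

/-- A dilation of the identity channel acts as a functional on the dilating system. -/
theorem exists_functional_of_mix_comp_conj_eq_id {G : Quant} (V : tensor B G →L[ℂ] B)
    (h : mix B G ≫ conj (A := B ⊗ G) V = 𝟙 B) :
    ∃ u : G →L[ℂ] ℂ, (∀ y g, V (y ⊗ₜ[ℂ] g) = u g • y) ∧ ∃ g, u g ≠ 0 := by
  -- The unitor is a dilation of the identity with one-dimensional environment; comparing `V` with
  -- it yields the functional.
  let r : tensor B unit →L[ℂ] B := TensorProduct.ridIsometry ℂ B
  have hr : r ∘L adjoint r = .id ℂ B := by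
    exact isometryEquiv_comp_adjoint (X := tensor B unit) (TensorProduct.ridIsometry ℂ B)
  obtain ⟨U, -, hU, -, -⟩ := exists_intertwiner r V fun ρ => by
    have h1 : r ∘L tmulOp ρ 1 = ρ ∘L r :=
      ContinuousLinearMap.coe_injective (TensorProduct.ext' fun y (c : ℂ) =>
        (map_smul ρ c y).symm)
    rw [← linMap_mix_comp_conj V, h]
    calc r ∘L tmulOp ρ 1 ∘L adjoint r = (r ∘L tmulOp ρ 1) ∘L adjoint r := rfl
      _ = ρ ∘L (r ∘L adjoint r) := by rw [h1]; rfl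
      _ = ρ := by rw [hr, comp_id]
  have hV : ∀ y g, V (y ⊗ₜ[ℂ] g) = U g • y := fun y g => by rw [← hU]; rfl
  refine ⟨U, hV, ?_⟩
  by_contra! hU0
  have hV0 : V = 0 := ContinuousLinearMap.coe_injective (TensorProduct.ext' fun y g =>
    (hV y g).trans (by rw [hU0, zero_smul]; rfl))
  refine id_ne_zero B ?_
  rw [← h, linMap_comp, hV0]
  exact congrArg (LinearMap.comp · (linMap (mix B G))) (linMap_conj_zero (A := B ⊗ G))

theorem exists_isIso_of_mixingMorphisms {f : A ⟶ B} (hf : mixingMorphisms mixedState f) :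
    ∃ (E : Quant) (p : A ⊗ E ⟶ B), IsIso p ∧ f = mix A E ≫ p := by
  obtain ⟨E, K, hfK, hK⟩ := exists_minimal_dilation f (linMap_ne_zero_of_mixingMorphisms hf)
  refine ⟨E, conj (A := A ⊗ E) K, ?_, hfK⟩
  have := (hf _ (pureMorphisms_conj (X := A ⊗ E) K)).hasLiftingProperty
  have sq : CommSq (mix A E) f (conj (A := A ⊗ E) K) (𝟙 B) := ⟨by rw [Category.comp_id, hfK]⟩
  obtain ⟨G, H, hH⟩ := exists_eq_mix_comp_conj sq.lift
  have hfac := sq.fac_left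
  have hfac' := sq.fac_right
  rw [hH, Category.assoc, conj_comp_conj] at hfac'
  obtain ⟨u, hu, g, hg⟩ :=
    exists_functional_of_mix_comp_conj_eq_id (K ∘L H : tensor B G →L[ℂ] B) hfac'
  let s : tensor A (tensor E G) →L[ℂ] tensor (tensor A E) G :=
    (TensorProduct.assocIsometry ℂ A E G).symm
  -- The identity of `A ⊗ E` dilates `mix A E`, and so does the composite of the dilations `K` of
  -- `f` and `H` of the lift.
  obtain ⟨T, -, hT, -, -⟩ := exists_intertwiner (.id ℂ (tensor A E) : tensor A E →L[ℂ] tensor A E)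
    (H ∘L mapL K (.id ℂ G) ∘L s) fun ρ => by
    have hs : s ∘L tmulOp ρ 1 = tmulOp (tmulOp ρ 1) 1 ∘L s := by
      refine ContinuousLinearMap.coe_injective (TensorProduct.ext' fun a x => ?_)
      induction x using TensorProduct.induction_on with
      | zero => rw [tmul_zero, map_zero, map_zero]
      | add x y hx hy => rw [tmul_add, map_add, map_add, hx, hy]
      | tmul e v => rfl
    have hss : s ∘L adjoint s = .id ℂ _ :=
      isometryEquiv_comp_adjoint (X := tensor A (tensor E G)) (Y := tensor (tensor A E) G)
        (TensorProduct.assocIsometry ℂ A E G).symm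
    have hKG : mapL K (.id ℂ G) ∘L mapL (tmulOp ρ 1) (1 : G.Op) ∘L adjoint (mapL K (.id ℂ G))
        = mapL (K ∘L tmulOp ρ 1 ∘L adjoint K) (1 : G.Op) := by
      rw [adjoint_mapL, ← mapL_comp, ← mapL_comp, adjoint_id, id_comp, comp_id]
    have h1 := conj_comp_of_intertwines s hs hss (H ∘L mapL K (.id ℂ G))
    have h2 := LinearMap.congr_fun (congrArg linMap hfac) ρ
    rw [linMap_mix, linMap_comp, LinearMap.comp_apply, hH, linMap_mix_comp_conj] at h2
    have h3 : linMap f ρ = K ∘L tmulOp ρ 1 ∘L adjoint K := by rw [hfK, linMap_mix_comp_conj]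
    rw [adjoint_id, id_comp, comp_id]
    refine (h2.symm.trans ?_).trans h1.symm
    rw [h3, adjoint_comp]
    change H ∘L mapL (K ∘L tmulOp ρ 1 ∘L adjoint K) (1 : G.Op) ∘L adjoint H = _
    rw [← hKG]
    rfl
  have hT' : ∀ x e g, H (K (x ⊗ₜ[ℂ] e) ⊗ₜ[ℂ] g) = x ⊗ₜ[ℂ] T (e ⊗ₜ[ℂ] g) := fun x e g =>
    (DFunLike.congr_fun hT (x ⊗ₜ[ℂ] (e ⊗ₜ[ℂ] g))).symm
  -- Applying `K` to `hT'` and using `hu` gives `K (x ⊗ T (e ⊗ g)) = u g • K (x ⊗ e)` for all `x`;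
  -- minimality of `K` removes `x`.
  have hTg : ∀ e, T (e ⊗ₜ[ℂ] g) = u g • e := fun e => by
    rw [← sub_eq_zero]
    refine hK _ fun x => ?_
    rw [tmul_sub, map_sub, ← hT', tmul_smul, sub_eq_zero]
    exact (hu _ _).trans (K.map_smul _ _).symm
  let R : B →L[ℂ] tensor A E := (u g)⁻¹ •
    LinearMap.toContinuousLinearMap (H.toLinearMap ∘ₗ (TensorProduct.mk ℂ B G).flip g)
  have hR : ∀ y, R y = (u g)⁻¹ • H (y ⊗ₜ[ℂ] g) := fun y => rfl
  have hKR : K ∘L R = .id ℂ B := by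
    ext y
    rw [ContinuousLinearMap.comp_apply, hR, map_smul]
    exact (congrArg ((u g)⁻¹ • ·) (hu y g)).trans (inv_smul_smul₀ hg y)
  have hRK : R ∘L K = .id ℂ _ := by
    refine ContinuousLinearMap.coe_injective (TensorProduct.ext' fun x e => ?_)
    change R (K (x ⊗ₜ[ℂ] e)) = x ⊗ₜ[ℂ] e
    rw [hR, hT', hTg, tmul_smul]
    exact inv_smul_smul₀ hg _
  exact ⟨conj (B := A ⊗ E) R,
    (conj_comp_conj _ _).trans ((congrArg (conj (A := A ⊗ E) (B := A ⊗ E)) hRK).trans (conj_id _)),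
    (conj_comp_conj (B := A ⊗ E) _ _).trans ((congrArg conj hKR).trans (conj_id _))⟩

end Quant

/-- In the category of nonzero finite-dimensional Hilbert spaces and completely positive maps, the
mixing morphisms are exactly the simple mixing maps. -/
theorem mainTheorem3 :
    mixingMorphisms Quant.mixedState = simpleMixingMaps Quant.mixedState := by
  refine le_antisymm (fun A B f hf => ?_) (simpleMixingMaps_le_mixingMorphisms _)
  obtain ⟨E, p, hp, rfl⟩ := Quant.exists_isIso_of_mixingMorphisms hf
  exact ⟨E, p, hp, Category.assoc _ _ _⟩
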